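/- Let $G$ be a finite group and $\alpha\ge 0$ an integer. The near-group fusion ring $K(G,\alpha)$ is the free abelian group on $G\cup\{X\}$ with multiplication extending that of $G$ and $gX=Xg=X$ $(g\in G)$, $X^2=\sum_{g\in G}g+\alpha X$, and with involution $g^*=g^{-1}$, $X^*=X$. A NIM-rep of a fusion ring $(R,\{b_i\})$ is an $R$-module with a $\mathbb Z$-basis $\{m_l\}_{l\in L}$ such that every $b_i\triangleright m_l$ is a non-negative integral combination of the basis and $(b_i\triangleright m_l,m_k)=(m_l,b_{i^*}\triangleright m_k)$ for the bilinear form $(m_l,m_k)=\delta_{l,k}$. It is irreducible if it is non-zero and no non-empty proper subset of the basis spans a submodule. It is admissible if there are a fusion category $\mathcal C$ over an algebraically closed field with $\mathrm{Gr}(\mathcal C)\cong R$ (as based rings), an algebra $P$ in $\mathcal C$ whose category $\mathsf{Mod}_{\mathcal C}\text{-}P$ of right modules is semisimple, with $\mathrm{Gr}(\mathsf{Mod}_{\mathcal C}\text{-}P)$ equivalent to the given NIM-rep, and an object $N$ of $\mathsf{Mod}_{\mathcal C}\text{-}P$ such that $[N]$ generates it as a $\mathbb Z_+$-module, i.e.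 every basis element is $x\triangleright[N]$ for some non-negative integral combination $x$ of the $b_i$. The associated algebra object is the internal endomorphism object $\underline{\mathrm{Hom}}(N,N)\in\mathcal C$, which represents $Y\mapsto \mathrm{Hom}(Y\otimes N,N)$ (it is $P$ when $N=P$). Let $M$ be an irreducible NIM-rep of $K(G,\alpha)$ that is admissible, realised by $(\mathcal C,P,N)$ as above; write $X_g$ $(g\in G)$ and $X$ for the simple objects of $\mathcal C$. Then $N$ is simple, $m_0:=[N]$ is a basis element of $M$, and one of the following holds. (1) One orbit $(H,c_{1,1})$: there are a subgroup $H\subseteq G$, an integer $c_{1,1}>0$ and a bijection $x\mapsto m_x$ from $G/H$ to the basis of $M$, with $m_H=m_0$, such that for $g\in G$, $x\in G/H$ $$g\triangleright m_x=m_{gx},\qquad X\triangleright m_x=c_{1,1}\sum_{y\in G/H}m_y .$$ Moreover $c_{1,1}$ divides $|H|$, $c_{1,1}^2\,|G:H|\ge |H|$ and $\alpha=c_{1,1}|G:H|-|H|/c_{1,1}$; and, as an object, $\underline{\mathrm{Hom}}(N,N)\cong\bigoplus_{h\in H}X_h\oplus c_{1,1}X$. (2) Two orbits $(H_1,H_2,0,c_{2,2})$: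 there are subgroups $H_1,H_2\subseteq G$, integers $c_{1,2}>0$, $c_{2,2}\ge 0$, and a bijection from $G/H_1\sqcup G/H_2$ to the basis of $M$, $x\mapsto m^i_x$ for $x\in G/H_i$, with $m^1_{H_1}=m_0$, such that $g\triangleright m^i_x=m^i_{gx}$ and $$X\triangleright m^1_x=c_{1,2}\sum_{y\in G/H_2}m^2_y,\qquad X\triangleright m^2_x=c_{1,2}\sum_{y\in G/H_1}m^1_y+c_{2,2}\sum_{y\in G/H_2}m^2_y$$ (so $c_{1,1}=0$). Moreover $\alpha=c_{2,2}|G:H_2|$, $|G|$ divides $|H_1||H_2|$ and $c_{1,2}^2=|H_1||H_2|/|G|$; and, as an object, $\underline{\mathrm{Hom}}(N,N)\cong\bigoplus_{h\in H_1}X_h$. -/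

import Mathlib

set_option linter.unusedSectionVars false

open CategoryTheory MonoidalCategory Limits

/-! ### Fusion rings -/

/-- A fusion ring: a ring `R` that is free over `ℤ` with a finite basis `b_i`, non-negative
structure constants, the identity being a basis element, and an involution `i ↦ i*` of the label
set that induces an anti-involution of `R` and satisfies `τ(b_i b_j) = δ_{i, j*}`, where `τ` is the
coefficient of the identity. -/
structure FusionRing (I R : Type*) [Finite I] [Ring R] where
  basis : Module.Basis I ℤ R
  nonneg : ∀ i j l, 0 ≤ basis.repr (basis i * basis j) l
  one : I
  basis_one : basis one = 1
  dual : I → I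
  dual_dual : Function.Involutive dual
  dual_mul : ∀ x y : R, basis.constr ℤ (fun i => basis (dual i)) (x * y) =
    basis.constr ℤ (fun i => basis (dual i)) y * basis.constr ℤ (fun i => basis (dual i)) x
  trace_dual : ∀ i j, i = dual j → basis.repr (basis i * basis j) one = 1
  trace_not_dual : ∀ i j, i ≠ dual j → basis.repr (basis i * basis j) one = 0

/-! ### Near-group fusion rings -/

/-- The underlying abelian group of the near-group ring `K(G, α)`: an element is
`grp + xcoeff · X` with `grp` in the integral group ring of `G`. -/
@[ext]
structure NearGroupRing (G : Type*) (α : ℕ) where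
  grp : MonoidAlgebra ℤ G
  xcoeff : ℤ

namespace NearGroupRing

variable {G : Type*} {α : ℕ}

noncomputable instance : Zero (NearGroupRing G α) := ⟨⟨0, 0⟩⟩
noncomputable instance : Add (NearGroupRing G α) := ⟨fun x y => ⟨x.grp + y.grp, x.xcoeff + y.xcoeff⟩⟩
noncomputable instance : Neg (NearGroupRing G α) := ⟨fun x => ⟨-x.grp, -x.xcoeff⟩⟩

@[simp] lemma zero_grp : (0 : NearGroupRing G α).grp = 0 := rfl
@[simp] lemma zero_xcoeff : (0 : NearGroupRing G α).xcoeff = 0 := rfl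
@[simp] lemma add_grp (x y : NearGroupRing G α) : (x + y).grp = x.grp + y.grp := rfl
@[simp] lemma add_xcoeff (x y : NearGroupRing G α) :
    (x + y).xcoeff = x.xcoeff + y.xcoeff := rfl
@[simp] lemma neg_grp (x : NearGroupRing G α) : (-x).grp = -x.grp := rfl
@[simp] lemma neg_xcoeff (x : NearGroupRing G α) : (-x).xcoeff = -x.xcoeff := rfl

noncomputable instance : AddCommGroup (NearGroupRing G α) where
  add_assoc x y z := by ext1 <;> simp [add_assoc]
  zero_add x := by ext1 <;> simp
  add_zero x := by ext1 <;> simp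
  neg_add_cancel x := by ext1 <;> simp
  add_comm x y := by ext1 <;> simp [add_comm]
  nsmul := nsmulRec
  zsmul := zsmulRec

variable [Group G] [Fintype G]

/-- The augmentation `ℤG → ℤ`, which sends every group element to `1`. -/
noncomputable def aug : MonoidAlgebra ℤ G →ₐ[ℤ] ℤ := MonoidAlgebra.lift ℤ ℤ G 1

/-- The sum of all group elements. -/
noncomputable def total (G : Type*) [Group G] [Fintype G] : MonoidAlgebra ℤ G :=
  ∑ g : G, MonoidAlgebra.of ℤ G g

@[simp] lemma aug_of (g : G) : aug (MonoidAlgebra.of ℤ G g) = 1 := by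
  simp [aug]

lemma aug_total : aug (total G) = (Fintype.card G : ℤ) := by
  simp [total, -MonoidAlgebra.of_apply]

lemma total_mul (a : MonoidAlgebra ℤ G) : total G * a = aug a • total G := by
  induction a using MonoidAlgebra.induction_on with
  | of g =>
    rw [aug_of, one_smul, total, Finset.sum_mul]
    simp_rw [← map_mul]
    exact Fintype.sum_equiv (Equiv.mulRight g) _ _ (fun _ => rfl)
  | add a b ha hb => rw [mul_add, ha, hb, map_add, add_smul]
  | smul r a ha => rw [mul_smul_comm, ha, map_smul, smul_eq_mul, mul_smul]

lemma mul_total (a : MonoidAlgebra ℤ G) : a * total G = aug a • total G := by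
  induction a using MonoidAlgebra.induction_on with
  | of g =>
    rw [aug_of, one_smul, total, Finset.mul_sum]
    simp_rw [← map_mul]
    exact Fintype.sum_equiv (Equiv.mulLeft g) _ _ (fun _ => rfl)
  | add a b ha hb => rw [add_mul, ha, hb, map_add, add_smul]
  | smul r a ha => rw [smul_mul_assoc, ha, map_smul, smul_eq_mul, mul_smul]

noncomputable instance : One (NearGroupRing G α) := ⟨⟨1, 0⟩⟩

/-- The bilinear extension of `g · h = gh`, `g X = X = X g`, `X² = ∑_g g + α X`. -/
noncomputable instance : Mul (NearGroupRing G α) :=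
  ⟨fun x y => ⟨x.grp * y.grp + (x.xcoeff * y.xcoeff) • total G,
    aug x.grp * y.xcoeff + x.xcoeff * aug y.grp + α * (x.xcoeff * y.xcoeff)⟩⟩

@[simp] lemma one_grp : (1 : NearGroupRing G α).grp = 1 := rfl
@[simp] lemma one_xcoeff : (1 : NearGroupRing G α).xcoeff = 0 := rfl
lemma mul_grp (x y : NearGroupRing G α) :
    (x * y).grp = x.grp * y.grp + (x.xcoeff * y.xcoeff) • total G := rfl
lemma mul_xcoeff (x y : NearGroupRing G α) :
    (x * y).xcoeff = aug x.grp * y.xcoeff + x.xcoeff * aug y.grp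
      + α * (x.xcoeff * y.xcoeff) := rfl

noncomputable instance : Ring (NearGroupRing G α) where
  __ := (inferInstance : AddCommGroup (NearGroupRing G α))
  one_mul x := by ext1 <;> simp [mul_grp, mul_xcoeff]
  mul_one x := by ext1 <;> simp [mul_grp, mul_xcoeff]
  zero_mul x := by ext1 <;> simp [mul_grp, mul_xcoeff]
  mul_zero x := by ext1 <;> simp [mul_grp, mul_xcoeff]
  left_distrib x y z := by
    ext1
    · simp only [mul_grp, add_grp, add_xcoeff, mul_add, add_smul]; abel
    · simp only [mul_xcoeff, add_grp, add_xcoeff, map_add]; ring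
  right_distrib x y z := by
    ext1
    · simp only [mul_grp, add_grp, add_xcoeff, add_mul, add_smul]; abel
    · simp only [mul_xcoeff, add_grp, add_xcoeff, map_add]; ring
  mul_assoc x y z := by
    ext1
    · simp only [mul_grp, mul_xcoeff, add_mul, mul_add, smul_mul_assoc, mul_smul_comm,
        total_mul, mul_total, mul_assoc, smul_smul, add_assoc, ← add_smul]
      congr 2
      ring
    · simp only [mul_grp, mul_xcoeff, map_add, map_mul, map_smul, aug_total, smul_eq_mul]
      ring

/-- Coordinates with respect to the basis `G ∪ {X}`; the label `Sum.inl g` stands for `g`, and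
`Sum.inr ()` for `X`. -/
noncomputable def coords : NearGroupRing G α ≃ₗ[ℤ] (G ⊕ Unit → ℤ) :=
  AddEquiv.toIntLinearEquiv
    { toFun := fun x => Sum.elim (fun g => x.grp.coeff g) (fun _ => x.xcoeff)
      invFun := fun f => ⟨∑ g : G, MonoidAlgebra.single g (f (Sum.inl g)), f (Sum.inr ())⟩
      left_inv := fun x => by
        ext1
        · classical
          ext g
          simp
        · rfl
      right_inv := fun f => by
        classical
        ext s
        rcases s with g | _
        · simp [Finsupp.single_apply]
        · rfl
      map_add' := fun x y => by
        ext s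
        rcases s with g | _ <;> simp }

/-- The basis `G ∪ {X}`. -/
noncomputable def basis : Module.Basis (G ⊕ Unit) ℤ (NearGroupRing G α) :=
  Module.Basis.ofEquivFun coords

lemma repr_inl (x : NearGroupRing G α) (g : G) : basis.repr x (Sum.inl g) = x.grp.coeff g := by
  simp [basis, coords]

lemma repr_inr (x : NearGroupRing G α) (u : Unit) : basis.repr x (Sum.inr u) = x.xcoeff := by
  simp [basis, coords]

lemma basis_inl (g : G) :
    (basis (Sum.inl g) : NearGroupRing G α) = ⟨MonoidAlgebra.of ℤ G g, 0⟩ := by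
  classical
  apply basis.repr.injective
  ext s
  rcases s with h | u
  · rw [Module.Basis.repr_self, repr_inl]; simp [Finsupp.single_apply]
  · rw [Module.Basis.repr_self, repr_inr]; simp

lemma basis_inr (u : Unit) : (basis (Sum.inr u) : NearGroupRing G α) = ⟨0, 1⟩ := by
  classical
  apply basis.repr.injective
  ext s
  rcases s with h | u
  · rw [Module.Basis.repr_self, repr_inl]; simp
  · rw [Module.Basis.repr_self, repr_inr]; simp

lemma grp_mul_grp (g h : G) : (basis (Sum.inl g) * basis (Sum.inl h) : NearGroupRing G α) =
    basis (Sum.inl (g * h)) := by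
  rw [basis_inl, basis_inl, basis_inl]
  ext1 <;> simp [mul_grp, mul_xcoeff]

lemma grp_mul_X (g : G) (u : Unit) :
    (basis (Sum.inl g) * basis (Sum.inr u) : NearGroupRing G α) = basis (Sum.inr u) := by
  rw [basis_inl, basis_inr]
  ext1 <;> simp [mul_grp, mul_xcoeff, -MonoidAlgebra.of_apply]

lemma X_mul_grp (g : G) (u : Unit) :
    (basis (Sum.inr u) * basis (Sum.inl g) : NearGroupRing G α) = basis (Sum.inr u) := by
  rw [basis_inl, basis_inr]
  ext1 <;> simp [mul_grp, mul_xcoeff, -MonoidAlgebra.of_apply]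

lemma X_mul_X (u v : Unit) : (basis (Sum.inr u) * basis (Sum.inr v) : NearGroupRing G α) =
    ∑ g : G, basis (Sum.inl g) + (α : ℤ) • basis (Sum.inr u) := by
  classical
  apply basis.repr.injective
  ext s
  rcases s with h | w
  · simp only [map_add, map_sum, map_smul, Finsupp.add_apply, Finsupp.smul_apply,
      Finsupp.finsetSum_apply, Module.Basis.repr_self]
    rw [repr_inl, basis_inr, mul_grp]
    simp [total, Finsupp.single_apply]
  · simp only [map_add, map_sum, map_smul, Finsupp.add_apply, Finsupp.smul_apply,
      Finsupp.finsetSum_apply, Module.Basis.repr_self]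
    rw [repr_inr, basis_inr, mul_xcoeff]
    simp

end NearGroupRing

/-- The near-group fusion ring `K(G, α)`, with `g* = g⁻¹` and `X* = X`. -/
noncomputable def nearGroup (G : Type*) [Group G] [Fintype G] (α : ℕ) :
    FusionRing (G ⊕ Unit) (NearGroupRing G α) where
  basis := NearGroupRing.basis
  nonneg i j l := by
    classical
    rcases i with g | u <;> rcases j with h | v
    · rw [NearGroupRing.grp_mul_grp, Module.Basis.repr_self, Finsupp.single_apply]
      split_ifs <;> simp
    · rw [NearGroupRing.grp_mul_X, Module.Basis.repr_self, Finsupp.single_apply]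
      split_ifs <;> simp
    · rw [NearGroupRing.X_mul_grp, Module.Basis.repr_self, Finsupp.single_apply]
      split_ifs <;> simp
    · rw [NearGroupRing.X_mul_X]
      simp only [map_add, map_sum, map_smul, Finsupp.add_apply, Finsupp.smul_apply,
        Module.Basis.repr_self, Finsupp.finsetSum_apply, Finsupp.single_apply, smul_eq_mul]
      refine add_nonneg (Finset.sum_nonneg fun i _ => ?_) (mul_nonneg (by positivity) ?_) <;>
        split_ifs <;> simp
  one := Sum.inl 1
  basis_one := by
    rw [NearGroupRing.basis_inl, map_one]; rfl
  dual := Sum.map (fun g => g⁻¹) id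
  dual_dual s := by rcases s with g | u <;> simp
  dual_mul x y := by
    let b : Module.Basis (G ⊕ Unit) ℤ (NearGroupRing G α) := NearGroupRing.basis
    let S := b.constr ℤ (fun i => b (Sum.map (fun g => g⁻¹) id i))
    have hS : ∀ i, S (b i) = b (Sum.map (fun g => g⁻¹) id i) := fun i => b.constr_basis ..
    have key : (LinearMap.mul ℤ (NearGroupRing G α)).compr₂ S =
        (LinearMap.mul ℤ (NearGroupRing G α)).flip.compl₁₂ S S := by
      refine LinearMap.ext_basis b b fun i j => ?_
      simp only [LinearMap.compr₂_apply, LinearMap.compl₁₂_apply, LinearMap.flip_apply,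
        LinearMap.mul_apply', hS]
      rcases i with g | u <;> rcases j with h | v
      · simp only [b, NearGroupRing.grp_mul_grp, Sum.map_inl]
        rw [hS, Sum.map_inl, mul_inv_rev]
      · simp only [b, NearGroupRing.grp_mul_X, NearGroupRing.X_mul_grp, Sum.map_inl, Sum.map_inr]
        rw [hS, Sum.map_inr]
      · simp only [b, NearGroupRing.grp_mul_X, NearGroupRing.X_mul_grp, Sum.map_inl, Sum.map_inr]
        rw [hS, Sum.map_inr]
      · simp only [b, NearGroupRing.X_mul_X, Sum.map_inr, id]
        rw [map_add, map_sum, map_smul, hS, Sum.map_inr]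
        congr 1
        refine (Finset.sum_congr rfl fun g _ => hS (Sum.inl g)).trans ?_
        exact Fintype.sum_equiv (Equiv.inv G) _ _ (fun _ => rfl)
    exact LinearMap.congr_fun₂ key x y
  trace_dual i j hij := by
    classical
    subst hij
    rcases j with g | u
    · simp [NearGroupRing.grp_mul_grp]
    · simp only [Sum.map_inr, id, NearGroupRing.X_mul_X, map_add, map_sum, map_smul,
        Finsupp.add_apply, Finsupp.smul_apply, Finsupp.finsetSum_apply, Module.Basis.repr_self]
      simp [Finsupp.single_apply]
  trace_not_dual i j hij := by
    classical
    rcases i with g | u <;> rcases j with h | v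
    · have : g * h ≠ 1 := fun e => hij (by simp [eq_inv_of_mul_eq_one_left e])
      simp [NearGroupRing.grp_mul_grp, this]
    · simp [NearGroupRing.grp_mul_X]
    · simp [NearGroupRing.X_mul_grp]
    · exact absurd rfl hij

/-! ### NIM-reps -/

/-- A NIM-rep of a fusion ring: an `R`-module `A` with a `ℤ`-basis `m_l` on which the `b_i` act by
non-negative integer matrices, and such that `(b_i ▷ m_l, m_k) = (m_l, b_{i*} ▷ m_k)` for the
symmetric bilinear form with `(m_l, m_k) = δ_{l,k}`. -/
structure NIMRep {I R : Type*} [Finite I] [Ring R] (F : FusionRing I R)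
    (L A : Type*) [AddCommGroup A] [Module R A] where
  basis : Module.Basis L ℤ A
  nonneg : ∀ i l k, 0 ≤ basis.repr (F.basis i • basis l) k
  rigid : ∀ i l k, basis.repr (F.basis i • basis l) k = basis.repr (F.basis (F.dual i) • basis k) l

namespace NIMRep

variable {I R : Type*} [Finite I] [Ring R] {F : FusionRing I R}
  {L A : Type*} [AddCommGroup A] [Module R A]

/-- The basis elements with labels in `S` span a sub-NIM-rep. -/
def IsSubrep (V : NIMRep F L A) (S : Set L) : Prop :=
  ∀ i, ∀ l ∈ S, F.basis i • V.basis l ∈ Submodule.span ℤ (V.basis '' S)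

/-- A NIM-rep is irreducible if it is non-zero and has no proper non-zero sub-NIM-rep. -/
def IsIrreducible (V : NIMRep F L A) : Prop :=
  Nonempty L ∧ ∀ S : Set L, S.Nonempty → V.IsSubrep S → S = Set.univ

end NIMRep

section Orbits

variable {G : Type*} [Group G] [Fintype G] {α : ℕ} {L A : Type*} [AddCommGroup A]
  [Module (NearGroupRing G α) A]

/-- The basis of the NIM-rep is one `G`-orbit, identified by `e` with `G ⧸ H`, and
`X ▷ m_x = c₁₁ ∑_y m_y`. -/
structure NIMRep.IsOneOrbit (V : NIMRep (nearGroup G α) L A) (H : Subgroup G) (c₁₁ : ℕ)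
    (e : G ⧸ H ≃ L) : Prop where
  grp_act : ∀ (g : G) (x : G ⧸ H),
    (nearGroup G α).basis (Sum.inl g) • V.basis (e x) = V.basis (e (g • x))
  X_act : ∀ x : G ⧸ H, (nearGroup G α).basis (Sum.inr ()) • V.basis (e x) =
    (c₁₁ : ℤ) • ∑ᶠ y : G ⧸ H, V.basis (e y)

/-- The basis of the NIM-rep is the union of two `G`-orbits, identified by `e` with `G ⧸ H₁` and
`G ⧸ H₂`, and `X` acts on the orbits by the symmetric matrix `(c_ij)`:
`X ▷ m^i_x = ∑_j c_ij ∑_y m^j_y`. -/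
structure NIMRep.IsTwoOrbit (V : NIMRep (nearGroup G α) L A) (H₁ H₂ : Subgroup G)
    (c₁₁ c₁₂ c₂₂ : ℕ) (e : (G ⧸ H₁) ⊕ (G ⧸ H₂) ≃ L) : Prop where
  grp_act₁ : ∀ (g : G) (x : G ⧸ H₁), (nearGroup G α).basis (Sum.inl g) • V.basis (e (Sum.inl x)) =
    V.basis (e (Sum.inl (g • x)))
  grp_act₂ : ∀ (g : G) (x : G ⧸ H₂), (nearGroup G α).basis (Sum.inl g) • V.basis (e (Sum.inr x)) =
    V.basis (e (Sum.inr (g • x)))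
  X_act₁ : ∀ x : G ⧸ H₁, (nearGroup G α).basis (Sum.inr ()) • V.basis (e (Sum.inl x)) =
    (c₁₁ : ℤ) • ∑ᶠ y : G ⧸ H₁, V.basis (e (Sum.inl y)) +
      (c₁₂ : ℤ) • ∑ᶠ y : G ⧸ H₂, V.basis (e (Sum.inr y))
  X_act₂ : ∀ x : G ⧸ H₂, (nearGroup G α).basis (Sum.inr ()) • V.basis (e (Sum.inr x)) =
    (c₁₂ : ℤ) • ∑ᶠ y : G ⧸ H₁, V.basis (e (Sum.inl y)) +
      (c₂₂ : ℤ) • ∑ᶠ y : G ⧸ H₂, V.basis (e (Sum.inr y))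

end Orbits

/-! ### Semisimple and fusion categories -/

section Categories

/-- `V` is the direct sum of the finite family `S`. -/
def IsDirectSum {D : Type*} [Category* D] [HasZeroMorphisms D] {ι : Type*} (S : ι → D)
    (V : D) : Prop :=
  ∃ b : Bicone S, Nonempty b.IsBilimit ∧ Nonempty (V ≅ b.pt)

/-- Every object is a finite direct sum of simple objects. -/
def IsSemisimpleCategory (D : Type*) [Category* D] [HasZeroMorphisms D] : Prop :=
  ∀ V : D, ∃ (n : ℕ) (S : Fin n → D), (∀ i, Simple (S i)) ∧ IsDirectSum S V

/-- A fusion category: a `k`-linear abelian rigid monoidal category with `k`-bilinear tensor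
product, which is semisimple, has finite-dimensional morphism spaces, finitely many isomorphism
classes of simple objects, and a simple unit object. -/
class IsFusionCategory (k C : Type*) [Field k] [Category* C] [Abelian C] [Linear k C]
    [MonoidalCategory C] [MonoidalPreadditive C] [MonoidalLinear k C] [RigidCategory C] :
    Prop where
  finiteDimensional : ∀ V W : C, FiniteDimensional k (V ⟶ W)
  semisimple : IsSemisimpleCategory C
  finite : ∃ (n : ℕ) (S : Fin n → C), ∀ V : C, Simple V → ∃ i, Nonempty (V ≅ S i)
  simple_unit : Simple (𝟙_ C)

/-- A labelling of the isomorphism classes of simple objects of `D` by the set `ι`. -/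
structure SimpleLabelling (ι D : Type*) [Category* D] [HasZeroMorphisms D] where
  obj : ι → D
  simple : ∀ i, Simple (obj i)
  inj : ∀ i j, Nonempty (obj i ≅ obj j) → i = j
  exhaustive : ∀ V : D, Simple V → ∃ i, Nonempty (V ≅ obj i)

/-- The multiplicity `[V : S] = dim Hom(S, V)` of the simple object `S` in `V` (in a semisimple
category over an algebraically closed field). -/
noncomputable def mult (k : Type*) [Field k] {D : Type*} [Category* D] [Preadditive D]
    [Linear k D] (S V : D) : ℕ :=
  Module.finrank k (S ⟶ V)

end Categories

/-! ### Right modules over an algebra in a monoidal category -/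

/-- A right module over the algebra `P` in `C`. -/
structure RightMod {C : Type*} [Category* C] [MonoidalCategory C] (P : C) [MonObj P] where
  X : C
  act : X ⊗ P ⟶ X
  act_act : act ▷ P ≫ act = (α_ X P P).hom ≫ X ◁ MonObj.mul (X := P) ≫ act
  act_one : X ◁ MonObj.one (X := P) ≫ act = (ρ_ X).hom

namespace RightMod

variable {C : Type*} [Category* C] [MonoidalCategory C] {P : C} [MonObj P]

/-- A morphism of right modules. -/
@[ext]
structure Hom (M N : RightMod P) where
  hom : M.X ⟶ N.X
  comm : M.act ≫ hom = hom ▷ P ≫ N.act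

instance : Category (RightMod P) where
  Hom := Hom
  id M := ⟨𝟙 M.X, by simp⟩
  comp f g := ⟨f.hom ≫ g.hom, by simp [reassoc_of% f.comm, g.comm]⟩

@[ext]
lemma hom_ext {M N : RightMod P} (f g : M ⟶ N) (h : f.hom = g.hom) : f = g := Hom.ext h

@[simp] lemma id_hom (M : RightMod P) : Hom.hom (𝟙 M) = 𝟙 M.X := rfl
@[simp] lemma comp_hom {M N K : RightMod P} (f : M ⟶ N) (g : N ⟶ K) :
    (f ≫ g).hom = f.hom ≫ g.hom := rfl

section Preadditive

variable [Preadditive C] [MonoidalPreadditive C]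

instance (M N : RightMod P) : Zero (M ⟶ N) := ⟨⟨0, by simp⟩⟩
instance (M N : RightMod P) : Add (M ⟶ N) :=
  ⟨fun f g => ⟨f.hom + g.hom, by simp [f.comm, g.comm]⟩⟩
instance (M N : RightMod P) : Neg (M ⟶ N) := ⟨fun f => ⟨-f.hom, by
    have h : (-f.hom) ▷ P = -(f.hom ▷ P) := (tensorRight P).map_neg
    simp [f.comm, h]⟩⟩

@[simp] lemma zero_hom (M N : RightMod P) : Hom.hom (0 : M ⟶ N) = 0 := rfl
@[simp] lemma add_hom {M N : RightMod P} (f g : M ⟶ N) : (f + g).hom = f.hom + g.hom := rfl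
@[simp] lemma neg_hom {M N : RightMod P} (f : M ⟶ N) : (-f).hom = -f.hom := rfl

instance (M N : RightMod P) : AddCommGroup (M ⟶ N) where
  add_assoc f g h := by ext; simp [add_assoc]
  zero_add f := by ext; simp
  add_zero f := by ext; simp
  neg_add_cancel f := by ext; simp
  add_comm f g := by ext; simp [add_comm]
  nsmul := nsmulRec
  zsmul := zsmulRec

instance : Preadditive (RightMod P) where
  add_comp _ _ _ f g h := by ext; simp
  comp_add _ _ _ f g h := by ext; simp

variable {k : Type*} [Field k] [Linear k C] [MonoidalLinear k C]

instance (M N : RightMod P) : SMul k (M ⟶ N) :=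
  ⟨fun r f => ⟨r • f.hom, by simp [f.comm]⟩⟩

@[simp] lemma smul_hom {M N : RightMod P} (r : k) (f : M ⟶ N) : (r • f).hom = r • f.hom := rfl

instance : Linear k (RightMod P) where
  homModule M N :=
    { one_smul := fun f => by ext; simp
      mul_smul := fun r s f => by ext; simp [mul_smul]
      smul_zero := fun r => by ext; simp
      smul_add := fun r f g => by ext; simp
      add_smul := fun r s f => by ext; simp [add_smul]
      zero_smul := fun f => by ext; simp }
  smul_comp _ _ _ r f g := by ext; simp
  comp_smul _ _ _ f r g := by ext; simp

end Preadditive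

/-- The action `X ↦ X ⊗ N` of `C` on the right module `N`; the algebra acts on the factor `N`. -/
@[simps]
def actOn (N : RightMod P) : C ⥤ RightMod P where
  obj X :=
    { X := X ⊗ N.X
      act := (α_ X N.X P).hom ≫ X ◁ N.act
      act_act := by
        have h := congrArg (fun t => X ◁ t) N.act_act
        simp only [MonoidalCategory.whiskerLeft_comp] at h
        simp only [comp_whiskerRight, Category.assoc, associator_naturality_middle_assoc,
          tensor_whiskerLeft, Iso.inv_hom_id_assoc, h]
        simp
      act_one := by
        have h := congrArg (fun t => X ◁ t) N.act_one
        simp only [MonoidalCategory.whiskerLeft_comp] at h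
        simp [h] }
  map f := ⟨f ▷ N.X, by simp [whisker_exchange]⟩
  map_id X := by ext; simp
  map_comp f g := by ext; simp

/-- `E` is the internal endomorphism object `Hom(N, N)`: it represents the functor
`X ↦ Hom(X ⊗ N, N)`. -/
def IsInternalEnd (N : RightMod P) (E : C) : Prop :=
  Nonempty (((actOn N).op ⋙ yoneda.obj N).RepresentableBy E)

end RightMod

/-! ### Admissible NIM-reps -/

/-- Data exhibiting a NIM-rep `V` of the fusion ring `F` as admissible over the fusion category `C`:
* an identification of `F` with the Grothendieck ring of `C`, matching the bases;
* an algebra `alg` in `C` whose category of right modules is semisimple;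
* an identification of `V` with the Grothendieck group of this `C`-module category, matching the
  bases and the actions;
* a right module `gen` whose class generates the Grothendieck group as a `ℤ₊`-module over the
  Grothendieck ring: every basis element is of the form `x ▷ [gen]` with `x` a non-negative
  combination of the `b_i`.

`V` is admissible if such data exist for some `C`. The algebra object attached to the data is the
internal endomorphism object `Hom(gen, gen)`; if `gen` is the regular right module, it is `alg`. -/
structure NIMRep.AdmissibleData (k C : Type*) [Field k] [Category* C] [Abelian C] [Linear k C]
    [MonoidalCategory C] [MonoidalPreadditive C] [MonoidalLinear k C]
    {I R : Type*} [Finite I] [Ring R] {F : FusionRing I R}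
    {L A : Type*} [AddCommGroup A] [Module R A] (V : NIMRep F L A) where
  simples : SimpleLabelling I C
  fusion : ∀ i j l, (mult k (simples.obj l) (simples.obj i ⊗ simples.obj j) : ℤ) =
    F.basis.repr (F.basis i * F.basis j) l
  alg : C
  [monObj : MonObj alg]
  semisimple : IsSemisimpleCategory (RightMod alg)
  modSimples : SimpleLabelling L (RightMod alg)
  action : ∀ i l l', (mult k (modSimples.obj l')
      ((RightMod.actOn (modSimples.obj l)).obj (simples.obj i)) : ℤ) =
    V.basis.repr (F.basis i • V.basis l) l'
  gen : RightMod alg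
  generates : ∀ l, ∃ x : R, (∀ i, 0 ≤ F.basis.repr x i) ∧
    x • (∑ᶠ l', (mult k (modSimples.obj l') gen : ℤ) • V.basis l') = V.basis l

attribute [instance] NIMRep.AdmissibleData.monObj

/-!
The generator is more restrictive than irreducibility. Write `v = [N]`. Basis elements are
indecomposable in the cone of non-negative vectors, so if a non-negative combination of the
`b_i ▷ v` is a basis element, then already some `b_i ▷ v` is that basis element
(`Module.Basis.exists_eq_of_sum_smul_eq`). Since group elements permute the basis, it follows that
`v` is itself a basis element `m₀` and that every basis element is either `g ▷ m₀` for some `g`, or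
`X ▷ m₀` (`NIMRep.exists_basis_eq_of_generates`).

* If all basis elements lie in the orbit of `m₀`, with stabilizer `H`, the relations
  `gX = X = Xg` make the matrix of `X` constant, equal to `c`, and `X² = ∑_g g + α X` reads
  `c² |G : H| = |H| + α c` (`NIMRep.exists_isOneOrbit`). All the numerical claims follow.
* Otherwise there is exactly one more basis element, `X ▷ m₀`, which is fixed by `G`. Symmetry of
  the matrix of `X` and the same relation force the orbit of `m₀` to be free, `c₁₂ = 1` and
  `c₂₂ = α` (`NIMRep.exists_isTwoOrbit`). So in the two-orbit case `H₂ = G` and `H₁` is trivial.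

On the categorical side, Schur's lemma holds in the category of right modules because it has
kernels, formed in `C`. Hence an object of a semisimple category is determined by its multiplicities
(`IsDirectSum.of_card_fiber_eq_mult`). This shows that `N` is simple, and it computes the internal
endomorphism object: the defining natural bijection is linear, so the multiplicity of `b_i` in it is
`dim Hom(b_i ⊗ N, N) = dim Hom(N, b_i ⊗ N)`, the coefficient of `m₀` in `b_i ▷ m₀`
(`NIMRep.AdmissibleData.mult_internalEnd`).
-/

/-! ### Direct sums in a linear category -/

section DirectSums

variable {D : Type*} [Category* D] [Preadditive D]

lemma IsDirectSum.of_equiv_of_iso {ι κ : Type*} {S : ι → D} {T : κ → D} {V : D}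
    [Fintype ι] [Fintype κ] (h : IsDirectSum S V) (e : κ ≃ ι) (w : ∀ k, T k ≅ S (e k)) :
    IsDirectSum T V := by
  classical
  obtain ⟨b, ⟨hb⟩, ⟨φ⟩⟩ := h
  let b' : Bicone T :=
    { pt := b.pt
      π := fun k => b.π (e k) ≫ (w k).inv
      ι := fun k => (w k).hom ≫ b.ι (e k)
      ι_π := fun k k' => by
        split_ifs with hk
        · subst hk; simp
        · have : b.ι (e k) ≫ b.π (e k') = 0 := by
            rw [b.ι_π, dif_neg (fun h => hk (e.injective h))]
          simp [reassoc_of% this] }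
  refine ⟨b', ⟨isBilimitOfTotal b' ?_⟩, ⟨φ⟩⟩
  have := IsBilimit.total hb
  rw [← this]
  exact Fintype.sum_equiv e _ _ (fun k => by simp [b'])

lemma IsDirectSum.iso_of_unique {ι : Type*} [Fintype ι] [Unique ι] {S : ι → D} {V : D}
    (h : IsDirectSum S V) : Nonempty (V ≅ S default) := by
  classical
  obtain ⟨b, ⟨hb⟩, ⟨φ⟩⟩ := h
  refine ⟨φ ≪≫ ⟨b.π default, b.ι default, ?_, by simp⟩⟩
  simpa using IsBilimit.total hb

variable (k : Type*) [Field k] [Linear k D]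

/-- `Hom(T, -)` turns a finite direct sum into a product. -/
lemma IsDirectSum.finrank_hom_right {ι : Type*} [Fintype ι] {S : ι → D} {V : D}
    [∀ V W : D, FiniteDimensional k (V ⟶ W)] (h : IsDirectSum S V) (T : D) :
    Module.finrank k (T ⟶ V) = ∑ i, Module.finrank k (T ⟶ S i) := by
  classical
  obtain ⟨b, ⟨hb⟩, ⟨φ⟩⟩ := h
  rw [← Module.finrank_pi_fintype k]
  refine ((Linear.homCongr k (Iso.refl T) φ).trans (LinearEquiv.ofBijective
    (LinearMap.pi fun i => Linear.rightComp k T (b.π i)) ⟨fun f g hfg => ?_, fun f => ?_⟩)).finrank_eq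
  · rw [← Category.comp_id f, ← Category.comp_id g, ← IsBilimit.total hb, Preadditive.comp_sum,
      Preadditive.comp_sum]
    refine Finset.sum_congr rfl fun i _ => ?_
    have : f ≫ b.π i = g ≫ b.π i := congrFun hfg i
    rw [reassoc_of% this]
  · refine ⟨∑ i, f i ≫ b.ι i, funext fun j => ?_⟩
    simp only [LinearMap.pi_apply, Linear.rightComp_apply, Preadditive.sum_comp, Category.assoc]
    rw [Finset.sum_eq_single j (fun i _ hij => by rw [b.ι_π, dif_neg hij, comp_zero]) (by simp)]
    simp

/-- `Hom(-, T)` turns a finite direct sum into a product. -/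
lemma IsDirectSum.finrank_hom_left {ι : Type*} [Fintype ι] {S : ι → D} {V : D}
    [∀ V W : D, FiniteDimensional k (V ⟶ W)] (h : IsDirectSum S V) (T : D) :
    Module.finrank k (V ⟶ T) = ∑ i, Module.finrank k (S i ⟶ T) := by
  classical
  obtain ⟨b, ⟨hb⟩, ⟨φ⟩⟩ := h
  rw [← Module.finrank_pi_fintype k]
  refine ((Linear.homCongr k φ (Iso.refl T)).trans (LinearEquiv.ofBijective
    (LinearMap.pi fun i => Linear.leftComp k T (b.ι i)) ⟨fun f g hfg => ?_, fun f => ?_⟩)).finrank_eq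
  · rw [← Category.id_comp f, ← Category.id_comp g, ← IsBilimit.total hb, Preadditive.sum_comp,
      Preadditive.sum_comp]
    refine Finset.sum_congr rfl fun i _ => ?_
    have : b.ι i ≫ f = b.ι i ≫ g := congrFun hfg i
    rw [Category.assoc, Category.assoc, this]
  · refine ⟨∑ i, b.π i ≫ f i, funext fun j => ?_⟩
    simp only [LinearMap.pi_apply, Linear.leftComp_apply, Preadditive.comp_sum]
    rw [Finset.sum_eq_single j
      (fun i _ hij => by rw [← Category.assoc, b.ι_π, dif_neg hij.symm, zero_comp]) (by simp)]
    simp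

/-! ### Multiplicities in a semisimple category -/

variable [IsAlgClosed k] [HasKernels D] [∀ V W : D, FiniteDimensional k (V ⟶ W)]

/-- In a semisimple category the multiplicity of a simple object is the same computed as a
subobject and as a quotient. -/
lemma finrank_hom_simple_comm (hD : IsSemisimpleCategory D) (V S : D) [Simple S] :
    Module.finrank k (V ⟶ S) = Module.finrank k (S ⟶ V) := by
  classical
  obtain ⟨n, T, hT, h⟩ := hD V
  rw [h.finrank_hom_left k, h.finrank_hom_right k]
  refine Finset.sum_congr rfl fun i _ => ?_
  have := hT i
  rw [finrank_hom_simple_simple k, finrank_hom_simple_simple k]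
  simp only [show Nonempty (T i ≅ S) ↔ Nonempty (S ≅ T i) from
    ⟨fun ⟨e⟩ => ⟨e.symm⟩, fun ⟨e⟩ => ⟨e.symm⟩⟩]

/-- An object of a semisimple category over an algebraically closed field is determined by its
multiplicities: `V` is the direct sum of any finite family of simple objects that contains every
simple object as often as `V` does. -/
lemma IsDirectSum.of_card_fiber_eq_mult (hD : IsSemisimpleCategory D) {ι : Type*}
    (Λ : SimpleLabelling ι D) (V : D) {κ : Type*} [Fintype κ] (f : κ → ι)
    (hf : ∀ i, Nat.card {j // f j = i} = mult k (Λ.obj i) V) :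
    IsDirectSum (fun j => Λ.obj (f j)) V := by
  classical
  obtain ⟨n, T, hT, h⟩ := hD V
  choose t ht using fun i => Λ.exhaustive (T i) (hT i)
  have hcard : ∀ i, Nat.card {j // f j = i} = Nat.card {j // t j = i} := fun i => by
    have hiso : ∀ j, Nonempty (Λ.obj i ≅ T j) ↔ t j = i := fun j =>
      ⟨fun ⟨e⟩ => (Λ.inj _ _ ⟨e ≪≫ (ht j).some⟩).symm, fun e => ⟨e ▸ (ht j).some.symm⟩⟩
    rw [hf, mult, h.finrank_hom_right k, Nat.card_eq_fintype_card, Fintype.card_subtype,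
      Finset.card_filter]
    refine Finset.sum_congr rfl fun j _ => ?_
    have := hT j
    have := Λ.simple i
    rw [finrank_hom_simple_simple k]
    simp only [hiso]
  have hequiv : ∀ i, Nonempty ({j // f j = i} ≃ {j // t j = i}) := fun i =>
    Finite.card_eq.1 (hcard i)
  -- Glue bijections between the fibres of the two labellings to a bijection of the index sets.
  let e : κ ≃ Fin n := (Equiv.sigmaFiberEquiv f).symm.trans
    ((Equiv.sigmaCongrRight fun i => (hequiv i).some).trans (Equiv.sigmaFiberEquiv t))
  have he : ∀ j, t (e j) = f j := fun j => ((hequiv (f j)).some ⟨j, rfl⟩).2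
  exact h.of_equiv_of_iso e fun j => eqToIso (by rw [he]) ≪≫ (ht (e j)).some.symm

end DirectSums

/-! ### The category of right modules -/

namespace RightMod

variable {C : Type*} [Category* C] [MonoidalCategory C] {P : C} [MonObj P]

section Kernels

variable [Preadditive C] [MonoidalPreadditive C] [HasKernels C]

/-- The kernel of a morphism of right modules, with the action inherited from the source. -/
@[simps]
noncomputable def kernelObj {M N : RightMod P} (f : M ⟶ N) : RightMod P where
  X := kernel f.hom
  act := kernel.lift f.hom (kernel.ι f.hom ▷ P ≫ M.act) (by
    rw [Category.assoc, f.comm, ← comp_whiskerRight_assoc, kernel.condition]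
    simp)
  act_act := by
    rw [← cancel_mono (kernel.ι f.hom)]
    simp only [Category.assoc, kernel.lift_ι]
    rw [← comp_whiskerRight_assoc, kernel.lift_ι, comp_whiskerRight_assoc, M.act_act,
      whisker_exchange_assoc]
    simp
  act_one := by
    rw [← cancel_mono (kernel.ι f.hom)]
    simp only [Category.assoc, kernel.lift_ι]
    rw [whisker_exchange_assoc, M.act_one]
    simp

/-- The inclusion of the kernel of a morphism of right modules. -/
@[simps]
noncomputable def kernelι {M N : RightMod P} (f : M ⟶ N) : kernelObj f ⟶ M :=
  (⟨kernel.ι f.hom, kernel.lift_ι _ _ _⟩ : Hom (kernelObj f) M)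

/-- The category of right modules has kernels, so that Schur's lemma applies to it. -/
instance : HasKernels (RightMod P) where
  has_limit {M N} f := by
    refine HasLimit.mk ⟨KernelFork.ofι (kernelι f) (hom_ext _ _ (kernel.condition _)), ?_⟩
    have hmono : Mono (kernelι f) := ⟨fun g h e =>
      hom_ext _ _ ((cancel_mono (kernel.ι f.hom)).1 (congrArg Hom.hom e))⟩
    refine KernelFork.IsLimit.ofι' (kernelι f) (hom_ext _ _ (kernel.condition _)) fun {K} g hg => ?_
    have hg' : g.hom ≫ f.hom = 0 := congrArg Hom.hom hg
    refine ⟨(⟨kernel.lift f.hom g.hom hg', ?_⟩ : Hom K (kernelObj f)), hom_ext _ _ (kernel.lift_ι _ _ _)⟩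
    change K.act ≫ kernel.lift f.hom g.hom hg' = kernel.lift f.hom g.hom hg' ▷ P ≫
      kernel.lift f.hom (kernel.ι f.hom ▷ P ≫ M.act) _
    rw [← cancel_mono (kernel.ι f.hom)]
    simp only [Category.assoc, kernel.lift_ι, g.comm]
    rw [← comp_whiskerRight_assoc, kernel.lift_ι]

end Kernels

section Linear

variable [Preadditive C] [MonoidalPreadditive C]
  {k : Type*} [Field k] [Linear k C] [MonoidalLinear k C]

lemma finiteDimensional_hom (hfin : ∀ V W : C, FiniteDimensional k (V ⟶ W)) (M N : RightMod P) :
    FiniteDimensional k (M ⟶ N) :=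
  have := hfin M.X N.X
  FiniteDimensional.of_injective
    ({ toFun := Hom.hom, map_add' := fun _ _ => rfl, map_smul' := fun _ _ => rfl } :
      (M ⟶ N) →ₗ[k] (M.X ⟶ N.X)) fun _ _ h => hom_ext _ _ h

/-- The natural bijection defining the internal endomorphism object is linear, so it preserves
dimensions. -/
lemma IsInternalEnd.finrank_hom {N : RightMod P} {E : C} (h : N.IsInternalEnd E) (Y : C) :
    Module.finrank k (Y ⟶ E) = Module.finrank k ((actOn N).obj Y ⟶ N) := by
  obtain ⟨r⟩ := h
  -- By naturality the bijection is composition with the evaluation `E ⊗ N ⟶ N`.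
  have hr : ∀ f : Y ⟶ E, r.homEquiv f = (actOn N).map f ≫ r.homEquiv (𝟙 E) := fun f => by
    have := r.homEquiv_comp f (𝟙 E)
    rw [Category.comp_id] at this
    exact this
  refine LinearEquiv.finrank_eq (LinearEquiv.ofBijective
    ({ toFun := fun f => r.homEquiv f
       map_add' := fun f g => ?_
       map_smul' := fun c f => ?_ } : (Y ⟶ E) →ₗ[k] ((actOn N).obj Y ⟶ N)) r.homEquiv.bijective)
  · rw [hr, hr f, hr g, ← Preadditive.add_comp]
    congr 1
    exact hom_ext _ _ (MonoidalPreadditive.add_whiskerRight _ _)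
  · rw [hr, hr f, RingHom.id_apply, ← Linear.smul_comp]
    congr 1
    exact hom_ext _ _ (MonoidalLinear.smul_whiskerRight _ _ _)

end Linear

/-- A morphism of modules induces a morphism between the actions of an object. -/
def actOnMap {M N : RightMod P} (φ : M ⟶ N) (Y : C) : (actOn M).obj Y ⟶ (actOn N).obj Y :=
  (⟨Y ◁ φ.hom, by
    change ((α_ Y M.X P).hom ≫ Y ◁ M.act) ≫ Y ◁ φ.hom =
      (Y ◁ φ.hom) ▷ P ≫ (α_ Y N.X P).hom ≫ Y ◁ N.act
    rw [Category.assoc, ← MonoidalCategory.whiskerLeft_comp, φ.comm]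
    simp⟩ : Hom ((actOn M).obj Y) ((actOn N).obj Y))

/-- Isomorphic modules give isomorphic actions of an object. -/
def actOnIso {M N : RightMod P} (φ : M ≅ N) (Y : C) : (actOn M).obj Y ≅ (actOn N).obj Y where
  hom := actOnMap φ.hom Y
  inv := actOnMap φ.inv Y
  hom_inv_id := hom_ext _ _ <| by
    change Y ◁ φ.hom.hom ≫ Y ◁ φ.inv.hom = 𝟙 (Y ⊗ M.X)
    rw [← MonoidalCategory.whiskerLeft_comp, ← comp_hom, φ.hom_inv_id, id_hom, whiskerLeft_id]
  inv_hom_id := hom_ext _ _ <| by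
    change Y ◁ φ.inv.hom ≫ Y ◁ φ.hom.hom = 𝟙 (Y ⊗ N.X)
    rw [← MonoidalCategory.whiskerLeft_comp, ← comp_hom, φ.inv_hom_id, id_hom, whiskerLeft_id]

end RightMod

/-! ### Indecomposability of basis elements -/

/-- A basis element is indecomposable in the cone of non-negative vectors: if a non-negative
combination of non-negative vectors is a basis element, then one of the vectors is that basis
element. -/
lemma Module.Basis.exists_eq_of_sum_smul_eq {L A ι : Type*} [AddCommGroup A]
    (b : Module.Basis L ℤ A) (s : Finset ι) (a : ι → ℤ) (w : ι → A) (ha : ∀ i, 0 ≤ a i)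
    (hw : ∀ i l, 0 ≤ b.repr (w i) l) {l : L} (h : ∑ i ∈ s, a i • w i = b l) :
    ∃ i ∈ s, a i = 1 ∧ w i = b l := by
  classical
  have hcoord : ∀ l', ∑ i ∈ s, a i * b.repr (w i) l' = if l = l' then 1 else 0 := fun l' => by
    have := congrArg (fun x => b.repr x l') h
    simpa [Finsupp.single_apply] using this
  have hnn : ∀ i l', 0 ≤ a i * b.repr (w i) l' := fun i l' => mul_nonneg (ha i) (hw i l')
  have hl := hcoord l
  rw [if_pos rfl] at hl
  obtain ⟨i, hi, hne⟩ := Finset.exists_ne_zero_of_sum_ne_zero (hl.trans_ne one_ne_zero)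
  have hle : a i * b.repr (w i) l ≤ 1 :=
    hl ▸ Finset.single_le_sum (f := fun i => a i * b.repr (w i) l) (fun j _ => hnn j l) hi
  have hone : a i * b.repr (w i) l = 1 := by have := hnn i l; omega
  have hai : a i = 1 := Int.eq_one_of_mul_eq_one_right (ha i) hone
  refine ⟨i, hi, hai, b.repr.injective (Finsupp.ext fun l' => ?_)⟩
  rw [b.repr_self, Finsupp.single_apply]
  split_ifs with hll
  · rw [← hll]; simpa [hai] using hone
  · have h0 := hcoord l'
    rw [if_neg hll] at h0
    have := (Finset.sum_eq_zero_iff_of_nonneg (fun j _ => hnn j l')).1 h0 i hi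
    simpa [hai] using this

namespace NIMRep

/-! ### The action of the group on the basis of a NIM-rep -/

lemma repr_smul_nonneg {I R L A : Type*} [Finite I] [Ring R] {F : FusionRing I R}
    [AddCommGroup A] [Module R A] (V : NIMRep F L A) (i : I) {v : A}
    (hv : ∀ l, 0 ≤ V.basis.repr v l) (l : L) : 0 ≤ V.basis.repr (F.basis i • v) l := by
  rw [← V.basis.linearCombination_repr v, Finsupp.linearCombination_apply, Finsupp.sum,
    Finset.smul_sum, map_sum, Finsupp.finsetSum_apply]
  refine Finset.sum_nonneg fun k _ => ?_
  rw [smul_comm, map_smul, Finsupp.smul_apply]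
  exact mul_nonneg (hv k) (V.nonneg i k l)

section NearGroup

variable {G : Type*} [Group G] [Fintype G] {α : ℕ} {L A : Type*} [AddCommGroup A]
  [Module (NearGroupRing G α) A] (V : NIMRep (nearGroup G α) L A)

lemma grp_smul_grp_smul (g h : G) (v : A) :
    (nearGroup G α).basis (Sum.inl g) • (nearGroup G α).basis (Sum.inl h) • v =
      (nearGroup G α).basis (Sum.inl (g * h)) • v := by
  rw [smul_smul]
  exact congrArg (· • v) (NearGroupRing.grp_mul_grp g h)

lemma one_grp_smul (v : A) : (nearGroup G α).basis (Sum.inl 1) • v = v := by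
  have : (nearGroup G α).basis (Sum.inl 1) = 1 := (nearGroup G α).basis_one
  rw [this, one_smul]

lemma X_smul_grp_smul (g : G) (v : A) :
    (nearGroup G α).basis (Sum.inr ()) • (nearGroup G α).basis (Sum.inl g) • v =
      (nearGroup G α).basis (Sum.inr ()) • v := by
  rw [smul_smul]
  exact congrArg (· • v) (NearGroupRing.X_mul_grp g ())

lemma grp_smul_X_smul (g : G) (v : A) :
    (nearGroup G α).basis (Sum.inl g) • (nearGroup G α).basis (Sum.inr ()) • v =
      (nearGroup G α).basis (Sum.inr ()) • v := by
  rw [smul_smul]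
  exact congrArg (· • v) (NearGroupRing.grp_mul_X g ())

lemma X_smul_X_smul (v : A) :
    (nearGroup G α).basis (Sum.inr ()) • (nearGroup G α).basis (Sum.inr ()) • v =
      ∑ g : G, (nearGroup G α).basis (Sum.inl g) • v +
        (α : ℤ) • (nearGroup G α).basis (Sum.inr ()) • v := by
  rw [smul_smul]
  refine (congrArg (· • v) (NearGroupRing.X_mul_X (G := G) (α := α) () ())).trans ?_
  rw [add_smul, Finset.sum_smul, smul_assoc]
  rfl

/-- A group element is invertible in the fusion ring and acts by a non-negative matrix, so it
permutes the basis. -/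
lemma exists_grp_smul_basis (g : G) (l : L) :
    ∃ l', (nearGroup G α).basis (Sum.inl g) • V.basis l = V.basis l' := by
  set w := (nearGroup G α).basis (Sum.inl g) • V.basis l with hw
  have hw' : (nearGroup G α).basis (Sum.inl g⁻¹) • w = V.basis l := by
    rw [hw, grp_smul_grp_smul, inv_mul_cancel, one_grp_smul]
  have hsum := hw'
  rw [← V.basis.linearCombination_repr w, Finsupp.linearCombination_apply, Finsupp.sum,
    Finset.smul_sum] at hsum
  simp_rw [smul_comm _ (V.basis.repr w _)] at hsum
  obtain ⟨l', -, -, h⟩ := V.basis.exists_eq_of_sum_smul_eq _ _ _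
    (fun k => V.nonneg _ l k) (fun k => V.nonneg _ k) hsum
  refine ⟨l', ?_⟩
  rw [hw, ← h, grp_smul_grp_smul, mul_inv_cancel, one_grp_smul]

/-- The action of `G` on the label set of a NIM-rep of `K(G, α)`: `g ▷ m_l = m_{gl}`. -/
@[reducible]
noncomputable def mulAction : MulAction G L where
  smul g l := (V.exists_grp_smul_basis g l).choose
  one_smul l := V.basis.injective <|
    (V.exists_grp_smul_basis 1 l).choose_spec.symm.trans (one_grp_smul _)
  mul_smul g h l := V.basis.injective <| by
    refine (V.exists_grp_smul_basis (g * h) l).choose_spec.symm.trans ?_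
    rw [← grp_smul_grp_smul, (V.exists_grp_smul_basis h l).choose_spec]
    exact (V.exists_grp_smul_basis g _).choose_spec

lemma grp_smul_basis (g : G) (l : L) : let _ := V.mulAction
    (nearGroup G α).basis (Sum.inl g) • V.basis l = V.basis (g • l) :=
  (V.exists_grp_smul_basis g l).choose_spec

/-- A non-negative vector that generates the NIM-rep over the non-negative part of `K(G, α)` is a
basis element `m_{l₀}`, and every basis element is of the form `g ▷ m_{l₀}` or `X ▷ m_{l₀}`. -/
lemma exists_basis_eq_of_generates [Nonempty L] {v : A} (hv : ∀ l, 0 ≤ V.basis.repr v l)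
    (hgen : ∀ l, ∃ x : NearGroupRing G α, (∀ i, 0 ≤ (nearGroup G α).basis.repr x i) ∧
      x • v = V.basis l) :
    ∃ l₀, v = V.basis l₀ ∧ ∀ l,
      (∃ g : G, V.basis l = (nearGroup G α).basis (Sum.inl g) • V.basis l₀) ∨
        V.basis l = (nearGroup G α).basis (Sum.inr ()) • V.basis l₀ := by
  have hgen' : ∀ l, ∃ i, (nearGroup G α).basis i • v = V.basis l := fun l => by
    obtain ⟨x, hx, h⟩ := hgen l
    rw [← (nearGroup G α).basis.sum_repr x, Finset.sum_smul] at h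
    simp_rw [smul_assoc] at h
    obtain ⟨i, -, -, hi⟩ := V.basis.exists_eq_of_sum_smul_eq _ _ _ hx
      (fun i => V.repr_smul_nonneg i hv) h
    exact ⟨i, hi⟩
  have key : ∃ l₀, v = V.basis l₀ := by
    by_cases hg : ∃ (l : L) (g : G), (nearGroup G α).basis (Sum.inl g) • v = V.basis l
    · obtain ⟨l, g, h⟩ := hg
      obtain ⟨l', h'⟩ := V.exists_grp_smul_basis g⁻¹ l
      refine ⟨l', ?_⟩
      rw [← h', ← h, grp_smul_grp_smul, inv_mul_cancel, one_grp_smul]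
    · -- Every basis element is `X ▷ v`, so there is only one, and `v` is a multiple of it.
      have hX : ∀ l, (nearGroup G α).basis (Sum.inr ()) • v = V.basis l := fun l => by
        obtain ⟨g | u, h⟩ := hgen' l
        · exact absurd ⟨l, g, h⟩ hg
        · exact h
      obtain ⟨l⟩ := ‹Nonempty L›
      have hX' := hX l
      rw [← V.basis.linearCombination_repr v, Finsupp.linearCombination_apply, Finsupp.sum,
        Finset.smul_sum] at hX'
      simp_rw [smul_comm _ (V.basis.repr v _)] at hX'
      obtain ⟨l', -, h1, -⟩ := V.basis.exists_eq_of_sum_smul_eq _ _ _ hv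
        (fun k => V.nonneg _ k) hX'
      have hall : ∀ k, k = l' := fun k => V.basis.injective ((hX k).symm.trans (hX l'))
      refine ⟨l', V.basis.repr.injective (Finsupp.ext fun k => ?_)⟩
      rw [hall k, h1, V.basis.repr_self, Finsupp.single_eq_same]
  obtain ⟨l₀, rfl⟩ := key
  refine ⟨l₀, rfl, fun l => ?_⟩
  obtain ⟨g | u, h⟩ := hgen' l
  · exact Or.inl ⟨g, h.symm⟩
  · exact Or.inr h.symm

/-! ### The matrix of `X` -/

/-- The coefficient of `m_{l'}` in `X ▷ m_l`. -/
noncomputable def coeffX (l l' : L) : ℤ :=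
  V.basis.repr ((nearGroup G α).basis (Sum.inr ()) • V.basis l) l'

lemma coeffX_nonneg (l l' : L) : 0 ≤ V.coeffX l l' := V.nonneg _ _ _

lemma coeffX_comm (l l' : L) : V.coeffX l l' = V.coeffX l' l := V.rigid (Sum.inr ()) l l'

lemma coeffX_smul_left (g : G) (l l' : L) : let _ := V.mulAction
    V.coeffX (g • l) l' = V.coeffX l l' := by
  intro _
  rw [coeffX, ← grp_smul_basis, X_smul_grp_smul, coeffX]

lemma coeffX_smul_right (g : G) (l l' : L) : let _ := V.mulAction
    V.coeffX l (g • l') = V.coeffX l l' := by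
  intro _
  rw [coeffX_comm, coeffX_smul_left, coeffX_comm]

lemma X_smul_basis_eq_sum {κ : Type*} [Fintype κ] (e : κ ≃ L) (l : L) :
    (nearGroup G α).basis (Sum.inr ()) • V.basis l = ∑ x, V.coeffX l (e x) • V.basis (e x) := by
  have : Fintype L := Fintype.ofEquiv κ e
  rw [Fintype.sum_equiv e _ (fun l' => V.coeffX l l' • V.basis l') (fun _ => rfl)]
  exact (V.basis.sum_repr _).symm

/-- The relation `X² = ∑_g g + α X` in coordinates. -/
lemma repr_X_smul_X_smul_basis (l l' : L) : let _ := V.mulAction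
    V.basis.repr ((nearGroup G α).basis (Sum.inr ()) • (nearGroup G α).basis (Sum.inr ()) •
      V.basis l) l' = Nat.card {g : G // g • l = l'} + α * V.coeffX l l' := by
  classical
  intro _
  rw [X_smul_X_smul, map_add, map_smul, Finsupp.add_apply, Finsupp.smul_apply, smul_eq_mul,
    coeffX, map_sum, Finsupp.finsetSum_apply]
  simp_rw [grp_smul_basis, Module.Basis.repr_self, Finsupp.single_apply]
  rw [Nat.card_eq_fintype_card, Fintype.card_subtype, Finset.sum_boole]

lemma sum_coeffX_mul_coeffX {κ : Type*} [Fintype κ] (e : κ ≃ L) (l l' : L) :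
    let _ := V.mulAction
    ∑ x, V.coeffX l (e x) * V.coeffX (e x) l' =
      Nat.card {g : G // g • l = l'} + α * V.coeffX l l' := by
  intro _
  rw [← repr_X_smul_X_smul_basis, V.X_smul_basis_eq_sum e l, Finset.smul_sum, map_sum,
    Finsupp.finsetSum_apply]
  refine Finset.sum_congr rfl fun x _ => ?_
  rw [smul_comm, map_smul, Finsupp.smul_apply, smul_eq_mul]
  rfl

/-! ### The two kinds of NIM-reps -/

/-- If the basis is a single orbit, the matrix of `X` is constant, and `X² = ∑_g g + α X` becomes
`c² |G : H| = |H| + α c`. -/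
lemma exists_isOneOrbit (l₀ : L)
    (h : ∀ l, ∃ g : G, V.basis l = (nearGroup G α).basis (Sum.inl g) • V.basis l₀) :
    ∃ (H : Subgroup G) (c : ℕ) (e : G ⧸ H ≃ L), e ((1 : G) : G ⧸ H) = l₀ ∧ V.IsOneOrbit H c e ∧
      c ^ 2 * H.index = Nat.card H + α * c := by
  classical
  let _ := V.mulAction
  let H := MulAction.stabilizer G l₀
  have hsurj : Function.Surjective (MulAction.ofQuotientStabilizer G l₀) := fun l => by
    obtain ⟨g, hg⟩ := h l
    exact ⟨(g : G ⧸ H), V.basis.injective (by rw [hg, grp_smul_basis]; rfl)⟩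
  let e : G ⧸ H ≃ L := Equiv.ofBijective _ ⟨MulAction.injective_ofQuotientStabilizer G l₀, hsurj⟩
  have he : ∀ g : G, e (g : G ⧸ H) = g • l₀ := fun g => rfl
  have hc : ∀ x y, V.coeffX (e x) (e y) = V.coeffX l₀ l₀ := fun x y => by
    induction x using QuotientGroup.induction_on with | H g
    induction y using QuotientGroup.induction_on with | H g'
    rw [he, he, coeffX_smul_left, coeffX_smul_right]
  have h1 : e ((1 : G) : G ⧸ H) = l₀ := by rw [he, one_smul]
  have hc' : ((V.coeffX l₀ l₀).toNat : ℤ) = V.coeffX l₀ l₀ :=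
    Int.toNat_of_nonneg (V.coeffX_nonneg _ _)
  refine ⟨H, (V.coeffX l₀ l₀).toNat, e, h1, ⟨fun g x => ?_, fun x => ?_⟩, ?_⟩
  · rw [grp_smul_basis]
    exact congrArg V.basis (MulAction.ofQuotientStabilizer_smul G l₀ g x).symm
  · rw [V.X_smul_basis_eq_sum e, finsum_eq_sum_of_fintype, hc', Finset.smul_sum]
    simp_rw [hc]
  · have key := V.sum_coeffX_mul_coeffX e (e ((1 : G) : G ⧸ H)) (e ((1 : G) : G ⧸ H))
    simp_rw [hc, h1] at key
    rw [Finset.sum_const, Finset.card_univ, ← Nat.card_eq_fintype_card, nsmul_eq_mul, ← hc'] at key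
    have key' : H.index * ((V.coeffX l₀ l₀).toNat * (V.coeffX l₀ l₀).toNat) =
      Nat.card H + α * (V.coeffX l₀ l₀).toNat := by exact_mod_cast key
    rw [← key']; ring

/-- If `X ▷ m_{l₀}` is a basis element outside the orbit of `m_{l₀}`, and there are no other basis
elements, then the second orbit is a fixed point and the first one is free. -/
lemma exists_isTwoOrbit (l₀ l₁ : L) (h₁ : (nearGroup G α).basis (Sum.inr ()) • V.basis l₀ = V.basis l₁)
    (hne : ∀ g : G, V.basis l₁ ≠ (nearGroup G α).basis (Sum.inl g) • V.basis l₀)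
    (h : ∀ l, l ≠ l₁ → ∃ g : G, V.basis l = (nearGroup G α).basis (Sum.inl g) • V.basis l₀) :
    ∃ (H : Subgroup G) (e : (G ⧸ H) ⊕ (G ⧸ (⊤ : Subgroup G)) ≃ L),
      e (Sum.inl ((1 : G) : G ⧸ H)) = l₀ ∧ V.IsTwoOrbit H ⊤ 0 1 α e ∧ Nat.card H = 1 := by
  classical
  let _ := V.mulAction
  have hne' : ∀ g : G, g • l₀ ≠ l₁ := fun g hg => hne g (by rw [grp_smul_basis, hg])
  have hfix : ∀ g : G, g • l₁ = l₁ := fun g => V.basis.injective <| by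
    rw [← grp_smul_basis, ← h₁, grp_smul_X_smul]
  have : Subsingleton (G ⧸ (⊤ : Subgroup G)) := QuotientGroup.subsingleton_quotient_top
  let _ : Unique (G ⧸ (⊤ : Subgroup G)) := uniqueOfSubsingleton ((1 : G) : G ⧸ (⊤ : Subgroup G))
  let H := MulAction.stabilizer G l₀
  let f : (G ⧸ H) ⊕ (G ⧸ (⊤ : Subgroup G)) → L :=
    Sum.elim (MulAction.ofQuotientStabilizer G l₀) (fun _ => l₁)
  have hf : Function.Bijective f := by
    constructor
    · refine (MulAction.injective_ofQuotientStabilizer G l₀).sumElim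
        (fun x y _ => Subsingleton.elim x y) (fun x y => ?_)
      induction x using QuotientGroup.induction_on with | H g
      exact hne' g
    · intro l
      by_cases hl : l = l₁
      · exact ⟨Sum.inr ((1 : G) : G ⧸ (⊤ : Subgroup G)), hl.symm⟩
      · obtain ⟨g, hg⟩ := h l hl
        exact ⟨Sum.inl (g : G ⧸ H), V.basis.injective (by rw [hg, grp_smul_basis]; rfl)⟩
  let e := Equiv.ofBijective f hf
  have he₁ : ∀ g : G, e (Sum.inl (g : G ⧸ H)) = g • l₀ := fun g => rfl
  have he₂ : ∀ x, e (Sum.inr x) = l₁ := fun x => rfl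
  have hc₀ : ∀ l, V.coeffX l₀ l = if l₁ = l then 1 else 0 := fun l => by
    rw [coeffX, h₁, V.basis.repr_self, Finsupp.single_apply]
  have hc₁ : ∀ l, V.coeffX l₁ l = Nat.card {g : G // g • l₀ = l} + α * V.coeffX l₀ l := fun l => by
    rw [← repr_X_smul_X_smul_basis, h₁, coeffX]
  have hl₀ : l₁ ≠ l₀ := fun h => hne' 1 (by rw [one_smul, h])
  have hc₁₀ : V.coeffX l₁ l₀ = 1 := by rw [coeffX_comm, hc₀, if_pos rfl]
  have hc₁₁ : V.coeffX l₁ l₁ = α := by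
    have : IsEmpty {g : G // g • l₀ = l₁} := ⟨fun g => hne' g.1 g.2⟩
    rw [hc₁, hc₀, if_pos rfl, Nat.card_of_isEmpty]
    simp
  have hH : Nat.card H = 1 := by
    have := hc₁ l₀
    rw [hc₁₀, hc₀, if_neg hl₀, mul_zero, add_zero] at this
    exact_mod_cast this.symm
  refine ⟨H, e, by rw [he₁, one_smul], ⟨fun g x => ?_, fun g x => ?_, fun x => ?_, fun x => ?_⟩, hH⟩
  · rw [grp_smul_basis]
    exact congrArg V.basis (MulAction.ofQuotientStabilizer_smul G l₀ g x).symm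
  · rw [grp_smul_basis, he₂, he₂, hfix]
  · induction x using QuotientGroup.induction_on with | H g
    rw [he₁, ← grp_smul_basis, X_smul_grp_smul, h₁,
      show ∑ᶠ y : G ⧸ (⊤ : Subgroup G), V.basis (e (Sum.inr y)) = V.basis l₁ from finsum_unique _]
    simp
  · have hc₁' : ∀ x, V.coeffX l₁ (e (Sum.inl x)) = 1 := fun x => by
      induction x using QuotientGroup.induction_on with | H g
      rw [he₁, coeffX_smul_right, hc₁₀]
    rw [V.X_smul_basis_eq_sum e, Fintype.sum_sum_type, finsum_eq_sum_of_fintype, finsum_unique]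
    simp only [he₂, hc₁', hc₁₁, Nat.cast_one, one_smul]
    simp

end NearGroup

end NIMRep

/-! ### The generator and its internal endomorphism object -/

namespace NIMRep.AdmissibleData

variable {k C : Type*} [Field k] [IsAlgClosed k] [Category* C] [Abelian C] [Linear k C]
  [MonoidalCategory C] [MonoidalPreadditive C] [MonoidalLinear k C] [RigidCategory C]
  [IsFusionCategory k C]
  {I R : Type*} [Finite I] [Ring R] {F : FusionRing I R}
  {L A : Type*} [AddCommGroup A] [Module R A] {V : NIMRep F L A} (D : V.AdmissibleData k C)

/-- The class of the generator in the NIM-rep. -/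
noncomputable def genClass : A :=
  ∑ᶠ l, (mult k (D.modSimples.obj l) D.gen : ℤ) • V.basis l

lemma repr_genClass_nonneg (l : L) : 0 ≤ V.basis.repr D.genClass l := by
  refine finsum_induction (p := fun v => 0 ≤ V.basis.repr v l) (by simp) (fun x y hx hy => ?_)
    (fun l' => ?_)
  · rw [map_add, Finsupp.add_apply]; exact add_nonneg hx hy
  · classical
    rw [map_smul, Finsupp.smul_apply, V.basis.repr_self, Finsupp.single_apply, smul_eq_mul]
    positivity

lemma mult_gen_eq [DecidableEq L] {l₀ : L} (h : D.genClass = V.basis l₀) (l : L) :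
    mult k (D.modSimples.obj l) D.gen = if l₀ = l then 1 else 0 := by
  -- The defining sum has finite support: otherwise its value is `0`, which is no basis element.
  have hfin : (Function.support fun l =>
      (mult k (D.modSimples.obj l) D.gen : ℤ) • V.basis l).Finite := by
    by_contra hinf
    have h0 : D.genClass = 0 := finsum_of_infinite_support hinf
    exact V.basis.ne_zero l₀ (h ▸ h0)
  have hrepr : V.basis.repr D.genClass l = mult k (D.modSimples.obj l) D.gen := by
    rw [genClass, finsum_eq_sum_of_support_subset _ (s := insert l hfin.toFinset) (by
      intro x hx; simpa using Or.inr hx)]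
    rw [map_sum, Finsupp.finsetSum_apply, Finset.sum_eq_single l]
    · simp
    · intro l' _ hne
      simp [hne]
    · simp
  rw [h, V.basis.repr_self, Finsupp.single_apply] at hrepr
  exact_mod_cast hrepr.symm

lemma finiteDimensional_rightMod_hom (M N : RightMod D.alg) : FiniteDimensional k (M ⟶ N) :=
  RightMod.finiteDimensional_hom (IsFusionCategory.finiteDimensional (k := k) (C := C)) M N

/-- A generator whose class is a basis element is the corresponding simple module. -/
lemma nonempty_gen_iso {l₀ : L} (h : D.genClass = V.basis l₀) :
    Nonempty (D.gen ≅ D.modSimples.obj l₀) := by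
  classical
  have := D.finiteDimensional_rightMod_hom
  refine (IsDirectSum.of_card_fiber_eq_mult k D.semisimple D.modSimples D.gen
    (fun _ : Unit => l₀) fun l => ?_).iso_of_unique
  rw [D.mult_gen_eq h, Nat.card_eq_fintype_card, Fintype.card_subtype, Finset.card_filter]
  simp

/-- The multiplicity of `b_i` in the internal endomorphism object of a simple module with class
`m_l` is the coefficient of `m_l` in `b_i ▷ m_l`. -/
lemma mult_internalEnd {l₀ : L} (h : Nonempty (D.gen ≅ D.modSimples.obj l₀)) {E : C}
    (hE : D.gen.IsInternalEnd E) (i : I) :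
    (mult k (D.simples.obj i) E : ℤ) = V.basis.repr (F.basis i • V.basis l₀) l₀ := by
  obtain ⟨φ⟩ := h
  have := D.finiteDimensional_rightMod_hom
  have := D.modSimples.simple l₀
  rw [← D.action i l₀ l₀, mult, mult, hE.finrank_hom,
    (Linear.homCongr k (RightMod.actOnIso φ (D.simples.obj i)) φ).finrank_eq,
    finrank_hom_simple_comm k D.semisimple]

/-- The internal endomorphism object of a simple generator is the direct sum of any family of
simple objects with the right multiplicities. -/
lemma isDirectSum_internalEnd {l₀ : L} (h : Nonempty (D.gen ≅ D.modSimples.obj l₀)) {E : C}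
    (hE : D.gen.IsInternalEnd E) {κ : Type*} [Fintype κ] (f : κ → I)
    (hf : ∀ i, (Nat.card {j // f j = i} : ℤ) = V.basis.repr (F.basis i • V.basis l₀) l₀) :
    IsDirectSum (fun j => D.simples.obj (f j)) E := by
  have := IsFusionCategory.finiteDimensional (k := k) (C := C)
  refine IsDirectSum.of_card_fiber_eq_mult k (IsFusionCategory.semisimple k) D.simples E f
    fun i => ?_
  have := hf i
  rw [← D.mult_internalEnd h hE i] at this
  exact_mod_cast this

end NIMRep.AdmissibleData

/-! ### Classification -/

lemma Subgroup.sum_coe_eq {G : Type*} [Group G] [DecidableEq G] (H : Subgroup G) [Fintype H]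
    [DecidablePred (· ∈ H)] (g : G) :
    (∑ h : H, if (h : G) = g then 1 else 0) = if g ∈ H then 1 else 0 := by
  split_ifs with hg
  · rw [Finset.sum_eq_single ⟨g, hg⟩ (fun h _ hne => if_neg fun e => hne (Subtype.ext e)) (by simp)]
    simp
  · exact Finset.sum_eq_zero fun h _ => if_neg fun e : (h : G) = g => hg (e ▸ h.2)

lemma QuotientGroup.smul_one_eq_one_iff {G : Type*} [Group G] (H : Subgroup G) (g : G) :
    g • ((1 : G) : G ⧸ H) = ((1 : G) : G ⧸ H) ↔ g ∈ H := by
  rw [MulAction.Quotient.smul_coe, smul_eq_mul, mul_one, eq_comm, QuotientGroup.eq]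
  simp

theorem mainTheorem6 {G : Type*} [Group G] [Fintype G] {α : ℕ}
    {L A : Type*} [AddCommGroup A] [Module (NearGroupRing G α) A]
    (V : NIMRep (nearGroup G α) L A) (hV : V.IsIrreducible)
    {k C : Type*} [Field k] [IsAlgClosed k] [Category* C] [Abelian C] [Linear k C]
    [MonoidalCategory C] [MonoidalPreadditive C] [MonoidalLinear k C] [RigidCategory C]
    [IsFusionCategory k C] (D : V.AdmissibleData k C) :
    (∃ (H : Subgroup G) (c₁₁ : ℕ) (e : G ⧸ H ≃ L),
      V.IsOneOrbit H c₁₁ e ∧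
      0 < c₁₁ ∧ c₁₁ ∣ Nat.card H ∧ Nat.card H ≤ c₁₁ ^ 2 * H.index ∧
      (α : ℚ) = c₁₁ * H.index - Nat.card H / c₁₁ ∧
      Nonempty (D.gen ≅ D.modSimples.obj (e ((1 : G) : G ⧸ H))) ∧
      ∀ E : C, D.gen.IsInternalEnd E →
        IsDirectSum (Sum.elim (fun h : H => D.simples.obj (Sum.inl (h : G)))
          (fun _ : Fin c₁₁ => D.simples.obj (Sum.inr ()))) E) ∨
    (∃ (H₁ H₂ : Subgroup G) (c₁₂ c₂₂ : ℕ) (e : (G ⧸ H₁) ⊕ (G ⧸ H₂) ≃ L),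
      V.IsTwoOrbit H₁ H₂ 0 c₁₂ c₂₂ e ∧
      α = c₂₂ * H₂.index ∧ 0 < c₁₂ ∧ Nat.card G ∣ Nat.card H₁ * Nat.card H₂ ∧
      c₁₂ ^ 2 = Nat.card H₁ * Nat.card H₂ / Nat.card G ∧
      Nonempty (D.gen ≅ D.modSimples.obj (e (Sum.inl ((1 : G) : G ⧸ H₁)))) ∧
      ∀ E : C, D.gen.IsInternalEnd E →
        IsDirectSum (fun h : H₁ => D.simples.obj (Sum.inl (h : G))) E) := by
  classical
  have := hV.1
  obtain ⟨l₀, hl₀, hcover⟩ := V.exists_basis_eq_of_generates D.repr_genClass_nonneg D.generates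
  have hgen := D.nonempty_gen_iso hl₀
  by_cases hone : ∀ l, ∃ g : G,
      V.basis l = (nearGroup G α).basis (Sum.inl g) • V.basis l₀
  · left
    obtain ⟨H, c, e, he, hV₁, hc⟩ := V.exists_isOneOrbit l₀ hone
    have hpos : 0 < c := by
      rcases Nat.eq_zero_or_pos c with rfl | h
      · have : 0 < Nat.card H := Nat.card_pos
        rw [zero_pow two_ne_zero, zero_mul, mul_zero, add_zero] at hc
        omega
      · exact h
    have hfin : Fintype (G ⧸ H) := Fintype.ofFinite _
    refine ⟨H, c, e, hV₁, hpos, ?_, ?_, ?_, he ▸ hgen, fun E hE => ?_⟩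
    · refine (Nat.dvd_add_left (dvd_mul_left c α)).1 (hc ▸ ?_)
      rw [pow_two, mul_assoc]
      exact dvd_mul_right c _
    · omega
    · have hc' : (c : ℚ) ^ 2 * H.index = Nat.card H + α * c := by exact_mod_cast hc
      have : (c : ℚ) ≠ 0 := by positivity
      field_simp
      linarith
    · have key := D.isDirectSum_internalEnd hgen hE
        (Sum.elim (fun h : H => Sum.inl (h : G)) (fun _ : Fin c => Sum.inr ())) fun i => ?_
      · convert key using 1
        funext j
        rcases j with h | j <;> rfl
      · rw [← he, Nat.card_eq_fintype_card, Fintype.card_subtype, Finset.card_filter,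
          Fintype.sum_sum_type]
        rcases i with g | u
        · rw [hV₁.grp_act, V.basis.repr_self, Finsupp.single_apply]
          simp only [e.apply_eq_iff_eq, QuotientGroup.smul_one_eq_one_iff, Sum.elim_inl,
            Sum.elim_inr, Sum.inl.injEq, reduceCtorEq, if_false, Finset.sum_const_zero, add_zero,
            H.sum_coe_eq]
          simp
        · rw [hV₁.X_act, finsum_eq_sum_of_fintype]
          simp [Finsupp.single_apply]
  · right
    push Not at hone
    obtain ⟨l₁, hl₁⟩ := hone
    have h₁ := (hcover l₁).resolve_left fun ⟨g, hg⟩ => hl₁ g hg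
    obtain ⟨H, e, he, hV₂, hH⟩ := V.exists_isTwoOrbit l₀ l₁ h₁.symm hl₁ fun l hl =>
      (hcover l).resolve_right fun h => hl (V.basis.injective (h.trans h₁.symm))
    refine ⟨H, ⊤, 1, α, e, hV₂, by simp, one_pos, ?_, ?_, he ▸ hgen,
      fun E hE => ?_⟩
    · rw [hH, one_mul, Subgroup.card_top]
    · rw [hH, one_mul, Subgroup.card_top, Nat.div_self Nat.card_pos, one_pow]
    refine D.isDirectSum_internalEnd hgen hE (fun h : H => Sum.inl (h : G)) fun i => ?_
    rw [← he, Nat.card_eq_fintype_card, Fintype.card_subtype, Finset.card_filter]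
    rcases i with g | u
    · rw [hV₂.grp_act₁, V.basis.repr_self, Finsupp.single_apply]
      simp only [e.apply_eq_iff_eq, QuotientGroup.smul_one_eq_one_iff, Sum.inl.injEq, H.sum_coe_eq]
      simp
    · have : Fintype (G ⧸ (⊤ : Subgroup G)) := Fintype.ofFinite _
      rw [hV₂.X_act₁, finsum_eq_sum_of_fintype (fun y : G ⧸ (⊤ : Subgroup G) => _)]
      simp
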